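/- Let $[0,1]^2$ be the unit square with the Euclidean metric, let $\mathscr{H}^1$ be the 1-dimensional Hausdorff measure on it, and let $J_f(\mathscr{H}^1)$ be the family of all Borel sets $A\subseteq[0,1]^2$ that can be covered by countably many compact sets $K_0,K_1,\ldots\subseteq[0,1]^2$ with $\mathscr{H}^1(K_n)<\infty$ for every $n$. Then every Borel set $B\subseteq[0,1]^2$ with $B\notin J_f(\mathscr{H}^1)$ contains a Borel set $C\subseteq B$ with $C\notin J_f(\mathscr{H}^1)$ and $\mathscr{H}^1(C)=0$. -/

import Mathlib

open Set MeasureTheory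
open scoped ENNReal

/-- The family `J_f(μ)` of all Borel subsets of `X` that can be covered by countably many compact
sets of finite `μ`-measure. -/
def Jf {X : Type*} [TopologicalSpace X] [MeasurableSpace X] [BorelSpace X] (μ : Measure X) :
    Set (Set X) :=
  {A | MeasurableSet A ∧
    ∃ K : ℕ → Set X, (∀ n, IsCompact (K n) ∧ μ (K n) < ∞) ∧ A ⊆ ⋃ n, K n}

/-- The square `[0,1]²` as a subspace of the Euclidean plane, with the Euclidean metric. -/
def EuclideanSquare : Set (EuclideanSpace ℝ (Fin 2)) :=
  {x | ∀ i, x i ∈ Icc (0 : ℝ) 1}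

/-- The 1-dimensional Hausdorff measure on the Euclidean square. -/
noncomputable def hausdorffOne : Measure EuclideanSquare :=
  Measure.hausdorffMeasure 1

/-! A Baire category argument. Write `B` as a continuous image of a Polish space and delete every
basic open set whose image is countably covered. On the nonempty closed remainder `F`, preimages of
compact sets of finite measure are nowhere dense. A `Gδ` set containing the image of a dense
sequence of `F` pulls back to a comeagre set, so its trace on `B` is not covered; yet it can be
chosen null. -/

open TopologicalSpace Filter Topology in
/-- A countable set is contained in a `Gδ` set of zero Hausdorff measure. -/
theorem exists_isOpen_seq_hausdorffMeasure_iInter_eq_zero {X : Type*} [EMetricSpace X]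
    [MeasurableSpace X] [BorelSpace X] {d : ℝ} (hd : 0 < d) (x : ℕ → X) :
    ∃ U : ℕ → Set X, (∀ n, IsOpen (U n)) ∧ (∀ n i, x i ∈ U n) ∧
      Measure.hausdorffMeasure d (⋂ n, U n) = 0 := by
  have hpos : ∀ n : ℕ, ((n : ℝ≥0∞) + 1)⁻¹ ≠ 0 := fun n => by simp
  choose ε hε hεs using fun n : ℕ => ENNReal.exists_pos_sum_of_countable' (hpos n) ℕ
  -- The first bound sends the mesh to zero; the second gives `diam ^ d ≤ ε n i`.
  let δ : ℕ → ℕ → ℝ≥0∞ := fun n i => min ((n : ℝ≥0∞) + 1)⁻¹ ((ε n i) ^ (1 / d))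
  have hδ : ∀ n i, 0 < δ n i := fun n i =>
    lt_min (pos_iff_ne_zero.2 (hpos n)) (ENNReal.rpow_pos_of_nonneg (hε n i) (by positivity))
  let t : ℕ → ℕ → Set X := fun n i => Metric.eball (x i) (δ n i / 2)
  have hdiam : ∀ n i, Metric.ediam (t n i) ≤ δ n i := fun n i =>
    Metric.ediam_eball_le.trans_eq (ENNReal.mul_div_cancel (by simp) (by simp))
  have hpow : ∀ n i, Metric.ediam (t n i) ^ d ≤ ε n i := fun n i => by
    refine (ENNReal.rpow_le_rpow ((hdiam n i).trans (min_le_right _ _)) hd.le).trans_eq ?_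
    rw [← ENNReal.rpow_mul, one_div_mul_cancel hd.ne', ENNReal.rpow_one]
  have hlim : Tendsto (fun n : ℕ => ((n : ℝ≥0∞) + 1)⁻¹) atTop (𝓝 0) := by
    have := (tendsto_add_atTop_iff_nat 1).2 ENNReal.tendsto_inv_nat_nhds_zero
    simpa using this
  refine ⟨fun n => ⋃ i, t n i, fun n => isOpen_iUnion fun i => Metric.isOpen_eball,
    fun n i => mem_iUnion.2 ⟨i, Metric.mem_eball_self (ENNReal.half_pos (hδ n i).ne')⟩, ?_⟩
  have hle := Measure.hausdorffMeasure_le_liminf_tsum d (⋂ n, ⋃ i, t n i)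
    (fun n : ℕ => ((n : ℝ≥0∞) + 1)⁻¹) hlim t
    (Eventually.of_forall fun n i => (hdiam n i).trans (min_le_left _ _))
    (Eventually.of_forall fun n => iInter_subset _ n)
  have hsum : Tendsto (fun n => ∑' i, Metric.ediam (t n i) ^ d) atTop (𝓝 0) :=
    tendsto_of_tendsto_of_tendsto_of_le_of_le tendsto_const_nhds hlim (fun _ => zero_le)
      fun n => (ENNReal.tsum_le_tsum (hpow n)).trans (hεs n).le
  rw [hsum.liminf_eq] at hle
  exact le_antisymm hle zero_le

open TopologicalSpace in
/-- If the image of a continuous map `f` on a Polish space is not covered by countably many members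
of a family `𝒦` of closed sets, then there is a sequence in the image such that every `Gδ`
set containing it meets the image in a set that is not covered by countably many members of `𝒦`. -/
theorem exists_seq_forall_iInter_not_covered {P X : Type*} [TopologicalSpace P] [PolishSpace P]
    [TopologicalSpace X] {𝒦 : Set (Set X)} (h𝒦 : ∀ K ∈ 𝒦, IsClosed K) {f : P → X}
    (hf : Continuous f) (hrange : ¬ ∃ S ⊆ 𝒦, S.Countable ∧ range f ⊆ ⋃₀ S) :
    ∃ x : ℕ → X, ∀ U : ℕ → Set X, (∀ n, IsOpen (U n)) → (∀ n i, x i ∈ U n) →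
      ¬ ∃ S ⊆ 𝒦, S.Countable ∧ range f ∩ ⋂ n, U n ⊆ ⋃₀ S := by
  let 𝒱 : Set (Set P) := {V ∈ countableBasis P | ∃ S ⊆ 𝒦, S.Countable ∧ f '' V ⊆ ⋃₀ S}
  have h𝒱c : 𝒱.Countable := (countable_countableBasis P).mono (sep_subset _ _)
  have h𝒱 : ∀ V : 𝒱, ∃ S ⊆ 𝒦, S.Countable ∧ f '' V ⊆ ⋃₀ S := fun V => V.2.2
  choose T hT𝒦 hTc hT using h𝒱
  have : Countable 𝒱 := h𝒱c
  have hTcov : f '' ⋃₀ 𝒱 ⊆ ⋃₀ ⋃ V, T V := by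
    rintro _ ⟨p, ⟨V, hV, hp⟩, rfl⟩
    obtain ⟨K, hK, hpK⟩ := hT ⟨V, hV⟩ ⟨p, hp, rfl⟩
    exact ⟨K, mem_iUnion.2 ⟨_, hK⟩, hpK⟩
  let F : Set P := (⋃₀ 𝒱)ᶜ
  have hFclosed : IsClosed F :=
    (isOpen_sUnion fun V hV => isOpen_of_mem_countableBasis hV.1).isClosed_compl
  have : PolishSpace F := hFclosed.polishSpace
  have : Nonempty F := by
    by_contra hne
    refine hrange ⟨⋃ V, T V, iUnion_subset hT𝒦, countable_iUnion hTc, ?_⟩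
    rintro _ ⟨p, rfl⟩
    refine hTcov ⟨p, ?_, rfl⟩
    by_contra hp
    exact hne ⟨⟨p, hp⟩⟩
  let g : F → X := fun p => f p
  have hg : Continuous g := hf.comp continuous_subtype_val
  -- Otherwise some basic `V` meeting `F` has `f '' (V ∩ F) ⊆ K`; adding `K` to the cover of the
  -- deleted part puts `V` in `𝒱`.
  have hKint : ∀ K ∈ 𝒦, interior (g ⁻¹' K) = ∅ := by
    intro K hK
    by_contra! hne
    obtain ⟨p, hp⟩ := hne
    obtain ⟨W, hW, hWeq⟩ := isOpen_induced_iff.1 (isOpen_interior (s := g ⁻¹' K))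
    have hpW : (p : P) ∈ W := by rw [← hWeq] at hp; exact hp
    obtain ⟨V, hV, hpV, hVW⟩ := (isBasis_countableBasis P).exists_subset_of_mem_open hpW hW
    refine p.2 ⟨V, ⟨hV, insert K (⋃ V, T V), insert_subset hK (iUnion_subset hT𝒦),
      (countable_iUnion hTc).insert K, ?_⟩, hpV⟩
    rintro _ ⟨q, hq, rfl⟩
    by_cases hqF : q ∈ F
    · have hqK : (⟨q, hqF⟩ : F) ∈ interior (g ⁻¹' K) := by rw [← hWeq]; exact hVW hq
      exact ⟨K, mem_insert _ _, (interior_subset hqK : _ ∈ g ⁻¹' K)⟩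
    · obtain ⟨L, hL, hqL⟩ := hTcov ⟨q, not_notMem.1 hqF, rfl⟩
      exact ⟨L, mem_insert_of_mem _ hL, hqL⟩
  refine ⟨fun i => g (denseSeq F i), fun U hU hxU ⟨S, hS𝒦, hSc, hS⟩ => ?_⟩
  have hUint : ∀ n, interior (g ⁻¹' U n)ᶜ = ∅ := fun n =>
    interior_eq_empty_iff_dense_compl.2 <| by
      rw [compl_compl]
      exact (denseRange_denseSeq F).mono (range_subset_iff.2 fun i => hxU n i)
  have : Countable S := hSc
  have hcover : ⋃ j : S ⊕ ℕ, Sum.elim (fun K : S => g ⁻¹' K) (fun n => (g ⁻¹' U n)ᶜ) j = univ := by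
    refine eq_univ_of_forall fun p => ?_
    by_cases hp : ∀ n, g p ∈ U n
    · obtain ⟨K, hK, hpK⟩ := hS ⟨⟨p, rfl⟩, mem_iInter.2 hp⟩
      exact mem_iUnion.2 ⟨Sum.inl ⟨K, hK⟩, hpK⟩
    · obtain ⟨n, hn⟩ := not_forall.1 hp
      exact mem_iUnion.2 ⟨Sum.inr n, hn⟩
  have hclosed : ∀ j : S ⊕ ℕ,
      IsClosed (Sum.elim (fun K : S => g ⁻¹' K) (fun n => (g ⁻¹' U n)ᶜ) j) := by
    rintro (K | n)
    · exact (h𝒦 K (hS𝒦 K.2)).preimage hg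
    · exact ((hU n).preimage hg).isClosed_compl
  obtain ⟨K | n, hj⟩ := nonempty_interior_of_iUnion_of_closed hclosed hcover
  · exact hj.ne_empty (hKint K (hS𝒦 K.2))
  · exact hj.ne_empty (hUint n)

theorem mem_Jf_iff {X : Type*} [TopologicalSpace X] [MeasurableSpace X] [BorelSpace X]
    {μ : Measure X} {A : Set X} :
    A ∈ Jf μ ↔ MeasurableSet A ∧
      ∃ S ⊆ {K | IsCompact K ∧ μ K < ∞}, S.Countable ∧ A ⊆ ⋃₀ S := by
  refine and_congr_right fun _ => ⟨?_, ?_⟩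
  · rintro ⟨K, hK, hA⟩
    exact ⟨range K, range_subset_iff.2 hK, countable_range K, by rwa [sUnion_range]⟩
  · rintro ⟨S, hS, hSc, hA⟩
    -- Inserting `∅` allows an enumeration by `ℕ` even when `S` is empty.
    obtain ⟨K, hK⟩ := (hSc.insert ∅).exists_eq_range (insert_nonempty ∅ S)
    refine ⟨K, fun n => ?_, ?_⟩
    · rcases hK ▸ mem_range_self n with h | h
      · simp [h]
      · exact hS h
    · rw [← sUnion_range, ← hK]
      exact hA.trans (sUnion_subset_sUnion (subset_insert _ _))

/-- In a Polish space, every Borel set outside `Jf` of a Hausdorff measure of positive dimension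
has a null Borel subset outside it. -/
theorem exists_subset_notMem_Jf_hausdorffMeasure_eq_zero {X : Type*} [EMetricSpace X]
    [PolishSpace X] [MeasurableSpace X] [BorelSpace X] {d : ℝ} (hd : 0 < d) {B : Set X}
    (hB : MeasurableSet B) (hBJ : B ∉ Jf (Measure.hausdorffMeasure d : Measure X)) :
    ∃ C ⊆ B, MeasurableSet C ∧ C ∉ Jf (Measure.hausdorffMeasure d : Measure X) ∧
      Measure.hausdorffMeasure d C = 0 := by
  rw [mem_Jf_iff] at hBJ
  have hBcov := fun h => hBJ ⟨hB, h⟩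
  have hBan := hB.analyticSet
  rw [AnalyticSet] at hBan
  obtain rfl | ⟨f, hf, rfl⟩ := hBan
  · exact (hBcov ⟨∅, empty_subset _, countable_empty, empty_subset _⟩).elim
  obtain ⟨x, hx⟩ := exists_seq_forall_iInter_not_covered (fun K hK => hK.1.isClosed) hf hBcov
  obtain ⟨U, hU, hxU, hnull⟩ := exists_isOpen_seq_hausdorffMeasure_iInter_eq_zero hd x
  refine ⟨range f ∩ ⋂ n, U n, inter_subset_left,
    hB.inter (MeasurableSet.iInter fun n => (hU n).measurableSet), fun h => ?_,
    measure_mono_null inter_subset_right hnull⟩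
  exact hx U hU hxU (mem_Jf_iff.1 h).2

theorem isClosed_euclideanSquare : IsClosed EuclideanSquare := by
  simp only [EuclideanSquare, ← mem_preimage, ofPred_forall]
  exact isClosed_iInter fun i => isClosed_Icc.preimage (by fun_prop)

theorem mainTheorem9 (B : Set EuclideanSquare) (hB : MeasurableSet B)
    (hBJ : B ∉ Jf hausdorffOne) :
    ∃ C : Set EuclideanSquare, C ⊆ B ∧ MeasurableSet C ∧ C ∉ Jf hausdorffOne ∧
      hausdorffOne C = 0 := by
  have : PolishSpace EuclideanSquare := isClosed_euclideanSquare.polishSpace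
  exact exists_subset_notMem_Jf_hausdorffMeasure_eq_zero one_pos hB hBJ
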